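/- Let $q>1$ be an integer, $G=(\mathbb{Z}/q\mathbb{Z})^\times$, $s>1$ a real number and $P\ge 2$ a real parameter. Throughout, $p$ denotes a prime number, $\mu$ is the Möbius function, $\exp G$ is the exponent of $G$, and $d(n)$ is the number of positive divisors of $n$. Let $\mathscr{G}$ be the set of cyclic subgroups of $G$. A subset $\mathcal{A}\subset G$ is a lattice-invariant class if it is the set of all generators of some $K\in\mathscr{G}$; let $G^\sharp$ be the set of these classes. The map $\mathcal{A}\mapsto\langle\mathcal{A}\rangle$ (subgroup generated by $\mathcal A$) is a bijection $G^\sharp\to\mathscr{G}$, through which rows and columns indexed by one of these sets may be indexed by the other. For $\mathcal{A}\in G^\sharp$ put $$\zeta_P(s;q,\mathcal{A})=\prod_{p\ge P,\ p\bmod q\in\mathcal{A}}(1-p^{-s})^{-1},\qquad V_s(1)=\bigl(\log\zeta_P(s;q,\mathcal{A})\bigr)_{\mathcal{A}\in G^\sharp}.$$ For a Dirichlet character $\chi$ modulo $q$ put $L_P(s,\chi)=\prod_{p\ge P}(1-\chi(p)/p^s)^{-1}$. For a subgroup $G_0$ of $G$ let $G_0^\perp$ be the group of characters modulo $q$ equal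 to $1$ on $G_0$, and for an integer $t\ge1$ put $$\gamma_s(G_0,t)=\log\prod_{\chi\in G_0^\perp}L_P(ts,\chi),\qquad \Gamma_s(t)=\bigl(\gamma_s(G_0,t)\bigr)_{G_0\in\mathscr{G}}.$$ Let $M_1^{-1}$ be the matrix whose entry at $(\mathcal{A},K)\in G^\sharp\times\mathscr{G}$ is $\mu(|\langle\mathcal{A}\rangle/K|)/|G/K|$ if $K\subset\langle\mathcal{A}\rangle$ and $0$ otherwise. For each divisor $d>1$ of $\exp G$ let $N_d$ be the matrix whose entry at $(B_0,B_1)\in\mathscr{G}\times\mathscr{G}$ is $$\sum_{K\subset B_0,\ |KB_1/K|=d}\mu(|B_0/K|),$$ the sum being over subgroups $K$. For a vector $W$, let $\|W\|=\max_i|W_i|$. Then all the Euler products above converge (those for $L_P$ at the points $ts$ with $t\ge1$ an integer), the products $\prod_{\chi\in G_0^\perp}L_P(ts,\chi)$ are positive real numbers, and for every integer $r\ge2$ $$\Bigl\|V_s(1)-\sum_{0\le v\le r-1}(-1)^v\sum_{d_1\cdots d_v\le 2^r}\frac{N_{d_1}}{d_1}\cdots\frac{N_{d_v}}{d_v}\,M_1^{-1}\,\Gamma_s(d_1\cdots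 d_v)\Bigr\|\le\frac12\Bigl(1+\frac{r-1}{|G^\sharp|}\Bigr)\Bigl(\frac{|G^\sharp|\,d(\exp G)}{2}\Bigr)^{r-1}\frac{1+P/(s2^r-1)}{P^{s2^r}},$$ where the inner sum is over the tuples $(d_1,\dots,d_v)$ of divisors of $\exp G$ other than $1$ with $d_1\cdots d_v\le 2^r$; for $v=0$ the empty product $d_1\cdots d_v$ is $1$ and the empty matrix product is the identity. -/

import Mathlib

open scoped BigOperators

noncomputable section

namespace LatticeEuler

section Group

variable (G : Type) [CommGroup G] [Finite G]

/-- The set of cyclic subgroups of `G`. -/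
abbrev CyclicSubgroup : Type := {K : Subgroup G // IsCyclic K}

/-- The lattice-invariant classes of `G`: the subsets consisting of all the elements of `G` that
generate a given cyclic subgroup. -/
abbrev LatticeClass : Type :=
  {A : Set G // ∃ K : Subgroup G, IsCyclic K ∧ A = {x : G | Subgroup.zpowers x = K}}

instance : Fintype (CyclicSubgroup G) := Fintype.ofFinite _

instance : Fintype (LatticeClass G) := Fintype.ofFinite _

instance : DecidableEq (CyclicSubgroup G) := Classical.decEq _

instance : DecidableEq (LatticeClass G) := Classical.decEq _

instance : Fintype (Subgroup G) := Fintype.ofFinite _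

end Group

section Matrices

variable {G : Type} [CommGroup G]

theorem closure_generators (K : Subgroup G) (hK : IsCyclic K) :
    Subgroup.closure {x : G | Subgroup.zpowers x = K} = K := by
  apply le_antisymm
  · rw [Subgroup.closure_le]
    intro x hx
    have hx' : Subgroup.zpowers x = K := hx
    rw [← hx']
    exact Subgroup.mem_zpowers x
  · obtain ⟨g, hg⟩ := (Subgroup.isCyclic_iff_exists_zpowers_eq_top K).1 hK
    have h1 : g ∈ Subgroup.closure {x : G | Subgroup.zpowers x = K} :=
      Subgroup.subset_closure hg
    calc K = Subgroup.zpowers g := hg.symm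
      _ ≤ _ := by rwa [Subgroup.zpowers_le]

/-- The one-to-one correspondence between lattice-invariant classes and cyclic subgroups:
a class `A` is sent to the subgroup `⟨A⟩` it generates, and a cyclic subgroup to the set of its
generators. -/
def classEquiv : LatticeClass G ≃ CyclicSubgroup G where
  toFun A := ⟨Subgroup.closure A.1, by
    obtain ⟨A, K, hK, rfl⟩ := A
    exact (closure_generators K hK).symm ▸ hK⟩
  invFun K := ⟨{x : G | Subgroup.zpowers x = K.1}, K.1, K.2, rfl⟩
  left_inv := by
    rintro ⟨A, K, hK, rfl⟩
    simp only [closure_generators K hK]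
  right_inv := by
    rintro ⟨K, hK⟩
    simp only [closure_generators K hK]

open Classical in
/-- The matrix `M₁⁻¹`, with rows indexed by classes and columns indexed by cyclic subgroups:
its entry at `(A, K)` is `μ(|⟨A⟩/K|) / |G/K|` when `K ⊆ ⟨A⟩`, and `0` otherwise. -/
def M1Inv : Matrix (LatticeClass G) (CyclicSubgroup G) ℝ := fun A K =>
  if K.1 ≤ Subgroup.closure A.1 then
    ((ArithmeticFunction.moebius (K.1.relIndex (Subgroup.closure A.1)) : ℤ) : ℝ) / (K.1.index : ℝ)
  else 0

open Classical in
/-- The matrix `N_d`, with rows and columns indexed by cyclic subgroups: its entry at `(B₀, B₁)`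
is the sum of `μ(|B₀/K|)` over the subgroups `K ⊆ B₀` such that `|K B₁ / K| = d`. -/
def N [Finite G] (d : ℕ) : Matrix (CyclicSubgroup G) (CyclicSubgroup G) ℝ := fun B₀ B₁ =>
  ∑ K : Subgroup G with K ≤ B₀.1 ∧ K.relIndex (K ⊔ B₁.1) = d,
    ((ArithmeticFunction.moebius (K.relIndex B₀.1) : ℤ) : ℝ)

/-- The matrix `N_d` with its rows and columns indexed by classes, through the correspondence
between classes and cyclic subgroups. -/
def NClass [Finite G] (d : ℕ) : Matrix (LatticeClass G) (LatticeClass G) ℝ :=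
  Matrix.reindex classEquiv.symm classEquiv.symm (N d)

end Matrices

section Euler

/-- The primes `p ≥ P`. -/
abbrev PrimeGE (P : ℝ) : Type := {p : ℕ // p.Prime ∧ P ≤ (p : ℝ)}

/-- The primes `p ≥ P` whose residue class modulo `q` belongs to `A`. -/
abbrev PrimeGEIn (P : ℝ) (q : ℕ) (A : Set (ZMod q)ˣ) : Type :=
  {p : ℕ // p.Prime ∧ P ≤ (p : ℝ) ∧ ∃ a ∈ A, (a : ZMod q) = (p : ZMod q)}

/-- The Euler factor `(1 - p^{-s})⁻¹`. -/
def zetaFactor (s : ℝ) (p : ℕ) : ℝ := (1 - (p : ℝ) ^ (-s))⁻¹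

/-- `ζ_P(s; q, A)`. -/
def zetaP (P : ℝ) (s : ℝ) (q : ℕ) (A : Set (ZMod q)ˣ) : ℝ :=
  ∏' p : PrimeGEIn P q A, zetaFactor s p.1

/-- The Euler factor `(1 - χ(p) / p^s)⁻¹`. -/
def LFactor {q : ℕ} (χ : DirichletCharacter ℂ q) (s : ℂ) (p : ℕ) : ℂ :=
  (1 - χ (p : ZMod q) / (p : ℂ) ^ s)⁻¹

/-- `L_P(s, χ)`. -/
def LP {q : ℕ} (P : ℝ) (s : ℂ) (χ : DirichletCharacter ℂ q) : ℂ :=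
  ∏' p : PrimeGE P, LFactor χ s p.1

variable {q : ℕ} [NeZero q]

open Classical in
/-- `G₀^⊥`: the characters modulo `q` that take the value `1` on `G₀`. -/
def perp (G₀ : Subgroup (ZMod q)ˣ) : Finset (DirichletCharacter ℂ q) :=
  {χ : DirichletCharacter ℂ q | ∀ g ∈ G₀, χ (g : ZMod q) = 1}

/-- The product of the `L_P(t s, χ)` over `χ ∈ G₀^⊥`, as a complex number. -/
def LProd (P s : ℝ) (G₀ : Subgroup (ZMod q)ˣ) (t : ℕ) : ℂ :=
  ∏ χ ∈ perp G₀, LP P (((t : ℝ) * s : ℝ) : ℂ) χ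

/-- `γ_s(G₀, t)`: the logarithm of the product of the `L_P(t s, χ)` over `χ ∈ G₀^⊥`, a product
which is a positive real number when `s > 1` and `t ≥ 1`. -/
def gammaS (P s : ℝ) (G₀ : Subgroup (ZMod q)ˣ) (t : ℕ) : ℝ :=
  Real.log (LProd P s G₀ t).re

/-- The vector `Γ_s(t)`, indexed by cyclic subgroups. -/
def GammaVec (q : ℕ) [NeZero q] (P s : ℝ) (t : ℕ) : CyclicSubgroup (ZMod q)ˣ → ℝ :=
  fun G₀ => gammaS P s G₀.1 t

/-- The vector `V_s(1)`, indexed by lattice-invariant classes. -/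
def VVec (q : ℕ) (P s : ℝ) : LatticeClass (ZMod q)ˣ → ℝ :=
  fun A => Real.log (zetaP P s q A.1)

/-- The tuples `(d₁, …, d_v)` of divisors of `exp G` distinct from `1`, where
`G = (ℤ/qℤ)ˣ`, such that `d₁ ⋯ d_v ≤ z`. -/
def divisorTuples (q v z : ℕ) : Finset (Fin v → ℕ) :=
  (Fintype.piFinset fun _ : Fin v => (Monoid.exponent (ZMod q)ˣ).divisors.erase 1).filter
    fun d => ∏ i, d i ≤ z

/-- The sum over `0 ≤ v ≤ r - 1` of `(-1)^v` times the sum over the tuples `(d₁, …, d_v)` with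
`d₁ ⋯ d_v ≤ 2^r` of `(N_{d₁}/d₁) ⋯ (N_{d_v}/d_v) M₁⁻¹ Γ_s(d₁ ⋯ d_v)`. -/
def approx (q : ℕ) [NeZero q] (P s : ℝ) (r : ℕ) : LatticeClass (ZMod q)ˣ → ℝ :=
  ∑ v ∈ Finset.range r, (-1 : ℝ) ^ v •
    ∑ d ∈ divisorTuples q v (2 ^ r),
      ((List.ofFn fun i : Fin v => ((d i : ℝ)⁻¹) • NClass (G := (ZMod q)ˣ) (d i)).prod
        * M1Inv).mulVec (GammaVec q P s (∏ i, d i))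

end Euler

end LatticeEuler

end

/-!
For a prime `p` whose class `u` in `G` has order `f` modulo `G₀`, the characters in `G₀^⊥` take each
`f`-th root of unity equally often as value at `p`. Hence `γ_s(G₀, t)` is the sum over the classes
`A` of `|G/G₀⟨A⟩| V_{fts}(1)_A` with `f = |G₀⟨A⟩/G₀|`, and applying `M₁⁻¹` gives the recursion
`M₁⁻¹ Γ_s(t) = V_{ts}(1) + ∑_{d > 1} (N_d / d) V_{tds}(1)`; that the term `d = 1` has the identity
as coefficient is Möbius inversion. Solving for `V_s(1)` and iterating leaves two remainders: the
tuples of length `r`, whose product is at least `2 ^ r`, and the shorter tuples whose product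
exceeds `2 ^ r`. Both are small because the entries of `N_d` are values of the convolution of `μ`
with a multiplicative function with values in `{0, 1}`, hence at most `1` in absolute value, and
because the `ℓ¹` norm of `V_{ts}(1)` has an upper bound that at least halves when `t` grows by `1`.
-/

namespace LatticeEuler

open scoped Matrix

section Characters

theorem prod_one_sub_subgroup {R : Type*} [CommRing R] [IsDomain R] (H : Subgroup Rˣ) [Fintype H]
    (x : R) : ∏ h : H, (1 - (h : Rˣ) * x) = 1 - x ^ Nat.card H := by
  obtain ⟨g, hg⟩ := IsCyclic.exists_generator (α := H)
  have hroot : IsPrimitiveRoot ((g : Rˣ) : R) (Nat.card H) := by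
    rw [IsPrimitiveRoot.coe_units_iff, IsPrimitiveRoot.coe_submonoidClass_iff,
      ← orderOf_eq_card_of_forall_mem_zpowers hg]
    exact IsPrimitiveRoot.orderOf g
  have hfactor := hroot.pow_sub_pow_eq_prod_sub_mul 1 x Nat.card_pos
  rw [one_pow] at hfactor
  rw [hfactor]
  refine Finset.prod_of_injOn (fun h : H => ((h : Rˣ) : R))
    (fun _ _ _ _ h => Subtype.ext (Units.ext h)) (fun h _ => ?_) (fun ζ hζ h => ?_) (fun _ _ => rfl)
  · have hpow : (h : Rˣ) ^ Nat.card H = 1 := congrArg Subtype.val (pow_card_eq_one' (x := h))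
    rw [Finset.mem_coe, Polynomial.mem_nthRootsFinset Nat.card_pos, ← Units.val_pow_eq_pow_val,
      hpow, Units.val_one]
  · obtain ⟨i, -, rfl⟩ :=
      hroot.eq_pow_of_pow_eq_one ((Polynomial.mem_nthRootsFinset Nat.card_pos _).1 hζ)
    exact absurd ⟨g ^ i, by simp⟩ h

theorem prod_one_sub_monoidHom {A R : Type*} [CommGroup A] [Fintype A] [CommRing R] [IsDomain R]
    (φ : A →* Rˣ) (x : R) :
    ∏ a, (1 - φ a * x) = (1 - x ^ Nat.card φ.range) ^ Nat.card φ.ker := by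
  classical
  have : Fintype φ.range := Fintype.ofFinite _
  have hfiber (h : φ.range) : Finset.card {a | φ.rangeRestrict a = h} = Nat.card φ.ker := by
    rw [MonoidHom.card_fiber_eq_of_mem_range φ.rangeRestrict
      (φ.rangeRestrict_surjective h) ⟨1, map_one _⟩, ← φ.ker_rangeRestrict]
    rw [Nat.card_eq_fintype_card, Fintype.card_subtype]
    simp_rw [MonoidHom.mem_ker]
  calc ∏ a, (1 - φ a * x)
      = ∏ h : φ.range, (1 - (h : Rˣ) * x) ^ Finset.card {a | φ.rangeRestrict a = h} := by
        simp_rw [← Finset.prod_const,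
          Finset.prod_fiberwise' Finset.univ φ.rangeRestrict fun h => 1 - (h : Rˣ) * x,
          MonoidHom.coe_rangeRestrict]
    _ = (1 - x ^ Nat.card φ.range) ^ Nat.card φ.ker := by
        simp_rw [hfiber, Finset.prod_pow, prod_one_sub_subgroup]

theorem relIndex_sup_zpowers_dvd_iff {G : Type*} [CommGroup G] (H : Subgroup G) (g : G) (k : ℕ) :
    H.relIndex (H ⊔ Subgroup.zpowers g) ∣ k ↔ g ^ k ∈ H := by
  have horder : H.relIndex (H ⊔ Subgroup.zpowers g) = orderOf (QuotientGroup.mk' H g) := by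
    rw [Subgroup.relIndex_sup_left, ← Nat.card_zpowers, ← MonoidHom.map_zpowers,
      ← Subgroup.relIndex_ker, QuotientGroup.ker_mk']
  rw [horder, orderOf_dvd_iff_pow_eq_one, ← map_pow, QuotientGroup.mk'_apply,
    QuotientGroup.eq_one_iff]

variable {q : ℕ} [NeZero q] (G₀ : Subgroup (ZMod q)ˣ) (g : (ZMod q)ˣ)

/-- `G₀^⊥` as a subgroup of the group of Dirichlet characters modulo `q`. -/
noncomputable def perpSubgroup : Subgroup (DirichletCharacter ℂ q) :=
  (MulChar.subgroupOrderIsoSubgroupMulChar (ZMod q) ℂ G₀).ofDual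

theorem mem_perpSubgroup {χ : DirichletCharacter ℂ q} : χ ∈ perpSubgroup G₀ ↔ χ ∈ perp G₀ := by
  simp [perpSubgroup, perp, MulChar.mem_subgroupOrderIsoSubgroupMulChar_iff]

theorem card_perpSubgroup : Nat.card (perpSubgroup G₀) = G₀.index :=
  MulChar.card_subgroupOrderIsoSubgroupMulChar

variable {G₀ g} in
theorem forall_perpSubgroup_eq_one_iff :
    (∀ χ : perpSubgroup G₀, χ.1 (g : ZMod q) = 1) ↔ g ∈ G₀ := by
  have h := MulChar.mem_subgroupOrderIsoSubgroupMulChar_symm_iff (M := ZMod q) (R := ℂ)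
    (X := perpSubgroup G₀) (m := g)
  rw [perpSubgroup, OrderDual.toDual_ofDual, OrderIso.symm_apply_apply] at h
  simpa [perpSubgroup] using h.symm

/-- Evaluation of the characters in `G₀^⊥` at a residue class. -/
noncomputable def perpEval : perpSubgroup G₀ →* ℂˣ where
  toFun χ := χ.1.toUnitHom g
  map_one' := by ext; simp
  map_mul' _ _ := by ext; simp

theorem coe_perpEval (χ : perpSubgroup G₀) : (perpEval G₀ g χ : ℂ) = χ.1 (g : ZMod q) :=
  MulChar.coe_toUnitHom _ _

theorem card_range_perpEval :
    Nat.card (perpEval G₀ g).range = G₀.relIndex (G₀ ⊔ Subgroup.zpowers g) := by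
  have : Finite (perpEval G₀ g).range := .of_surjective _ (perpEval G₀ g).rangeRestrict_surjective
  refine Nat.dvd_right_iff_eq.1 fun k => ?_
  rw [relIndex_sup_zpowers_dvd_iff, ← forall_perpSubgroup_eq_one_iff, ← IsCyclic.exponent_eq_card,
    Monoid.exponent_dvd_iff_forall_pow_eq_one,
    (perpEval G₀ g).rangeRestrict_surjective.forall]
  simp [Units.ext_iff, Subtype.ext_iff, coe_perpEval]

theorem card_ker_perpEval :
    Nat.card (perpEval G₀ g).ker = (G₀ ⊔ Subgroup.zpowers g).index := by
  have hcard := (perpEval G₀ g).ker.card_mul_index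
  rw [Subgroup.index_ker, card_range_perpEval, card_perpSubgroup,
    ← Subgroup.relIndex_mul_index (le_sup_left : G₀ ≤ G₀ ⊔ Subgroup.zpowers g), mul_comm] at hcard
  exact Nat.eq_of_mul_eq_mul_left (Nat.pos_of_ne_zero Subgroup.FiniteIndex.index_ne_zero) hcard

theorem prod_perp_one_sub (x : ℂ) :
    ∏ χ ∈ perp G₀, (1 - χ (g : ZMod q) * x) =
      (1 - x ^ G₀.relIndex (G₀ ⊔ Subgroup.zpowers g)) ^ (G₀ ⊔ Subgroup.zpowers g).index := by
  have : Fintype (perpSubgroup G₀) := Fintype.ofFinite _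
  rw [← card_range_perpEval, ← card_ker_perpEval, ← prod_one_sub_monoidHom]
  simp_rw [coe_perpEval]
  exact Finset.prod_subtype _ (fun _ => (mem_perpSubgroup G₀).symm) _

end Characters

section Moebius

open ArithmeticFunction in
theorem abs_mul_moebius_le_one {f : ArithmeticFunction ℤ} (hf : f.IsMultiplicative)
    (hf₀ : ∀ n, 0 ≤ f n) (hf₁ : ∀ n, f n ≤ 1) (n : ℕ) : |(f * moebius) n| ≤ 1 := by
  rcases eq_or_ne n 0 with rfl | hn
  · simp
  have hmul : (f * moebius).IsMultiplicative := hf.mul isMultiplicative_moebius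
  have hsum (m : ℕ) : ∑ d ∈ m.divisors, (f * moebius) d = f m := by
    rw [← coe_mul_zeta_apply, mul_assoc, moebius_mul_coe_zeta, mul_one]
  have hpow {p : ℕ} (hp : p.Prime) (k : ℕ) :
      (f * moebius) (p ^ (k + 1)) = f (p ^ (k + 1)) - f (p ^ k) := by
    rw [← hsum, ← hsum (p ^ k), Nat.sum_divisors_prime_pow hp, Nat.sum_divisors_prime_pow hp,
      Finset.sum_range_succ, add_sub_cancel_left]
  rw [hmul.multiplicative_factorization _ hn, Finsupp.prod, Finset.abs_prod]
  refine Finset.prod_le_one (fun _ _ => abs_nonneg _) fun p hp => ?_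
  obtain ⟨k, hk⟩ := Nat.exists_eq_succ_of_ne_zero (Finsupp.mem_support_iff.1 hp)
  rw [hk, hpow (Nat.prime_of_mem_primeFactors hp), abs_le]
  constructor <;> linarith [hf₀ (p ^ k), hf₁ (p ^ k), hf₀ (p ^ (k + 1)), hf₁ (p ^ (k + 1))]

/-- The indicator function of the positive integers coprime to `c`. -/
def coprimeIndicator (c : ℕ) : ArithmeticFunction ℤ :=
  ⟨fun n => if n ≠ 0 ∧ n.Coprime c then 1 else 0, by simp⟩

theorem coprimeIndicator_apply (c n : ℕ) :
    coprimeIndicator c n = if n ≠ 0 ∧ n.Coprime c then 1 else 0 :=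
  rfl

theorem isMultiplicative_coprimeIndicator (c : ℕ) : (coprimeIndicator c).IsMultiplicative := by
  refine ArithmeticFunction.IsMultiplicative.iff_ne_zero.2 ⟨?_, fun {m n} hm hn _ => ?_⟩
  · simp [coprimeIndicator_apply]
  · simp only [coprimeIndicator_apply, Nat.coprime_mul_iff_left, mul_ne_zero hm hn, hm, hn, ne_eq,
      not_false_eq_true, true_and]
    split_ifs <;> simp_all

theorem coprimeIndicator_one : coprimeIndicator 1 = ArithmeticFunction.zeta := by
  ext n
  by_cases hn : n = 0 <;> simp [coprimeIndicator_apply, hn]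

theorem abs_coprimeIndicator_mul_moebius_le_one (c n : ℕ) :
    |(coprimeIndicator c * ArithmeticFunction.moebius) n| ≤ 1 := by
  refine abs_mul_moebius_le_one (isMultiplicative_coprimeIndicator c) (fun m => ?_) (fun m => ?_) n
  all_goals rw [coprimeIndicator_apply]; split_ifs <;> simp

theorem sum_divisors_coprime_moebius (b c : ℕ) :
    ∑ k ∈ b.divisors with k.gcd c = 1, ArithmeticFunction.moebius (b / k) =
      (coprimeIndicator c * ArithmeticFunction.moebius) b := by
  rw [ArithmeticFunction.mul_apply,
    Nat.sum_divisorsAntidiagonal fun k l => coprimeIndicator c k * ArithmeticFunction.moebius l,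
    Finset.sum_filter]
  refine Finset.sum_congr rfl fun k hk => ?_
  simp [coprimeIndicator_apply, Nat.Coprime, (Nat.pos_of_mem_divisors hk).ne']

theorem sum_divisors_gcd_eq_moebius (b c : ℕ) {e : ℕ} (he : 0 < e) :
    ∑ k ∈ (e * b).divisors with k.gcd (e * c) = e, ArithmeticFunction.moebius (e * b / k) =
      (coprimeIndicator c * ArithmeticFunction.moebius) b := by
  rw [← sum_divisors_coprime_moebius]
  symm
  refine Finset.sum_nbij (e * ·) (fun k hk => ?_)
    (fun _ _ _ _ h => Nat.eq_of_mul_eq_mul_left he h) (fun k hk => ?_)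
    (fun k _ => by rw [Nat.mul_div_mul_left _ _ he])
  · simp only [Finset.mem_filter, Nat.mem_divisors] at hk ⊢
    exact ⟨⟨mul_dvd_mul_left e hk.1.1, mul_ne_zero he.ne' hk.1.2⟩,
      by rw [Nat.gcd_mul_left, hk.2, mul_one]⟩
  · simp only [Finset.coe_filter, Set.mem_ofPred_eq, Nat.mem_divisors] at hk
    obtain ⟨⟨hdvd, hne⟩, hgcd⟩ := hk
    obtain ⟨k, rfl⟩ : e ∣ k := by
      rw [← hgcd]
      exact Nat.gcd_dvd_left _ _
    rw [Nat.gcd_mul_left, Nat.mul_eq_left he.ne'] at hgcd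
    refine ⟨k, ?_, rfl⟩
    simp only [Finset.coe_filter, Set.mem_ofPred_eq, Nat.mem_divisors]
    exact ⟨⟨Nat.dvd_of_mul_dvd_mul_left he hdvd, right_ne_zero_of_mul hne⟩, hgcd⟩

end Moebius

section CyclicSubgroups

variable {G : Type*} [CommGroup G] [Finite G] {B C K : Subgroup G}

theorem card_inf_ker_powMonoidHom (hB : IsCyclic B) (n : ℕ) :
    Nat.card ↥(B ⊓ (powMonoidHom n : G →* G).ker) = (Nat.card B).gcd n := by
  have hmap : (powMonoidHom n : B →* B).ker.map B.subtype = B ⊓ (powMonoidHom n : G →* G).ker := by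
    ext x
    simp [MonoidHom.mem_ker, Subtype.ext_iff]
    tauto
  rw [← IsCyclic.card_powMonoidHom_ker, ← hmap, Subgroup.card_map_of_injective B.subtype_injective]

theorem eq_inf_ker_powMonoidHom_card (hB : IsCyclic B) (hK : K ≤ B) :
    K = B ⊓ (powMonoidHom (Nat.card K) : G →* G).ker := by
  refine Subgroup.eq_of_le_of_card_ge (le_inf hK fun x hx => ?_) ?_
  · exact congrArg Subtype.val (pow_card_eq_one' (x := (⟨x, hx⟩ : K)))
  · rw [card_inf_ker_powMonoidHom hB]
    exact Nat.gcd_le_right _ Nat.card_pos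

theorem card_inf_of_le_isCyclic (hB : IsCyclic B) (hK : K ≤ B) (hC : C ≤ B) :
    Nat.card ↥(K ⊓ C) = (Nat.card K).gcd (Nat.card C) := by
  have hinf : K ⊓ C = B ⊓ (powMonoidHom ((Nat.card K).gcd (Nat.card C)) : G →* G).ker := by
    conv_lhs => rw [eq_inf_ker_powMonoidHom_card hB hK, eq_inf_ker_powMonoidHom_card hB hC]
    ext x
    simp only [Subgroup.mem_inf, MonoidHom.mem_ker, powMonoidHom_apply,
      ← orderOf_dvd_iff_pow_eq_one, Nat.dvd_gcd_iff]
    tauto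
  rw [hinf, card_inf_ker_powMonoidHom hB, Nat.gcd_eq_right]
  exact (Nat.gcd_dvd_left _ _).trans (Subgroup.card_dvd_of_le hK)

theorem card_mul_relIndex {G : Type*} [Group G] {K B : Subgroup G} (hK : K ≤ B) :
    Nat.card K * K.relIndex B = Nat.card B := by
  rw [← Subgroup.relIndex_bot_left, ← Subgroup.relIndex_bot_left,
    Subgroup.relIndex_mul_relIndex _ _ _ bot_le hK]

theorem gcd_card_mul_relIndex_sup (hB : IsCyclic B) (hK : K ≤ B) (C : Subgroup G) :
    (Nat.card K).gcd (Nat.card ↥(B ⊓ C)) * K.relIndex (K ⊔ C) = Nat.card C := by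
  rw [← card_inf_of_le_isCyclic hB hK inf_le_left, ← inf_assoc, inf_of_le_left hK,
    Subgroup.relIndex_sup_left, ← Subgroup.inf_relIndex_right, card_mul_relIndex inf_le_right]

open Classical in
theorem sum_subgroup_le_isCyclic [Fintype (Subgroup G)] {M : Type*} [AddCommMonoid M]
    (hB : IsCyclic B) (f : ℕ → M) :
    ∑ K : Subgroup G with K ≤ B, f (Nat.card K) = ∑ k ∈ (Nat.card B).divisors, f k := by
  refine Finset.sum_nbij (fun K => Nat.card K) (fun K hK => ?_) (fun K hK L hL h => ?_)
    (fun k hk => ?_) (fun _ _ => rfl)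
  · exact Nat.mem_divisors.2
      ⟨Subgroup.card_dvd_of_le (Finset.mem_filter.1 hK).2, Nat.card_pos.ne'⟩
  · rw [eq_inf_ker_powMonoidHom_card hB (Finset.mem_filter.1 hK).2,
      eq_inf_ker_powMonoidHom_card hB (Finset.mem_filter.1 hL).2]
    simp only [h]
  · refine ⟨B ⊓ (powMonoidHom k : G →* G).ker, by simp, ?_⟩
    simp only [card_inf_ker_powMonoidHom hB, Nat.gcd_eq_right (Nat.dvd_of_mem_divisors hk)]

end CyclicSubgroups

section MatrixN

variable {G : Type} [CommGroup G] [Finite G] (B₀ B₁ : CyclicSubgroup G)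

theorem N_eq_sum_divisors (d : ℕ) :
    N d B₀ B₁ = ((∑ k ∈ (Nat.card B₀.1).divisors with
      k.gcd (Nat.card ↥(B₀.1 ⊓ B₁.1)) * d = Nat.card B₁.1,
      ArithmeticFunction.moebius (Nat.card B₀.1 / k) : ℤ) : ℝ) := by
  classical
  rw [Int.cast_sum, Finset.sum_filter, ← sum_subgroup_le_isCyclic B₀.2, N, ← Finset.filter_filter,
    Finset.sum_filter]
  refine Finset.sum_congr rfl fun K hK => ?_
  have hK : K ≤ B₀.1 := (Finset.mem_filter.1 hK).2
  have hgcd : 0 < (Nat.card K).gcd (Nat.card ↥(B₀.1 ⊓ B₁.1)) :=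
    Nat.gcd_pos_of_pos_left _ Nat.card_pos
  have hrel : K.relIndex B₀.1 = Nat.card B₀.1 / Nat.card K := by
    rw [← card_mul_relIndex hK, Nat.mul_div_cancel_left _ Nat.card_pos]
  refine if_congr ?_ (by rw [hrel]) rfl
  rw [← gcd_card_mul_relIndex_sup B₀.2 hK B₁.1, Nat.mul_right_inj hgcd.ne', eq_comm]

variable {B₀ B₁} in
theorem N_eq_coprimeIndicator_mul_moebius {b c d e : ℕ} (hd : d ≠ 0) (hb : Nat.card B₀.1 = e * b)
    (hc : Nat.card ↥(B₀.1 ⊓ B₁.1) = e * c) (he : Nat.card B₁.1 = e * d) :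
    N d B₀ B₁ = ((coprimeIndicator c * ArithmeticFunction.moebius) b : ℤ) := by
  have he₀ : 0 < e := Nat.pos_of_mul_pos_right (he ▸ Nat.card_pos)
  rw [N_eq_sum_divisors, ← sum_divisors_gcd_eq_moebius b c he₀, hb, hc, he]
  simp_rw [Nat.mul_left_inj hd]

theorem N_eq_zero {d : ℕ} (h : ∀ e, e ∣ Nat.card ↥(B₀.1 ⊓ B₁.1) → e * d ≠ Nat.card B₁.1) :
    N d B₀ B₁ = 0 := by
  rw [N_eq_sum_divisors, Finset.filter_false_of_mem fun k _ => h _ (Nat.gcd_dvd_right _ _)]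
  simp

theorem abs_N_le_one {d : ℕ} (hd : d ≠ 0) : |N d B₀ B₁| ≤ 1 := by
  by_cases h : ∃ e, e ∣ Nat.card ↥(B₀.1 ⊓ B₁.1) ∧ e * d = Nat.card B₁.1
  · obtain ⟨e, ⟨c, hc⟩, he⟩ := h
    obtain ⟨b, hb⟩ : e ∣ Nat.card B₀.1 :=
      (Dvd.intro c hc.symm).trans (Subgroup.card_dvd_of_le inf_le_left)
    rw [N_eq_coprimeIndicator_mul_moebius hd hb hc he.symm]
    exact_mod_cast abs_coprimeIndicator_mul_moebius_le_one c b
  · rw [N_eq_zero B₀ B₁ fun e hec he => h ⟨e, hec, he⟩]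
    simp

theorem N_one : N (G := G) 1 = 1 := by
  ext B₀ B₁
  by_cases h : B₁.1 ≤ B₀.1
  · obtain ⟨b, hb⟩ := Subgroup.card_dvd_of_le h
    have hb₁ : b = 1 ↔ B₀ = B₁ := by
      refine ⟨fun h₁ => Subtype.ext (Subgroup.eq_of_le_of_card_ge h ?_).symm, ?_⟩
      · rw [hb, h₁, mul_one]
      · rintro rfl
        exact (Nat.mul_eq_left Nat.card_pos.ne').1 hb.symm
    rw [N_eq_coprimeIndicator_mul_moebius one_ne_zero hb (c := 1)
      (by rw [inf_of_le_right h, mul_one]) (by rw [mul_one]), coprimeIndicator_one,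
      ArithmeticFunction.coe_zeta_mul_moebius, ArithmeticFunction.one_apply, Matrix.one_apply]
    simp [hb₁]
  · rw [N_eq_zero, Matrix.one_apply_ne]
    · rintro rfl
      exact h le_rfl
    · intro e he hcard
      rw [mul_one] at hcard
      have hinf := Subgroup.eq_of_le_of_card_ge (inf_le_right : B₀.1 ⊓ B₁.1 ≤ B₁.1)
        (hcard ▸ Nat.le_of_dvd Nat.card_pos he)
      exact h (hinf ▸ inf_le_left)

end MatrixN

section PrimeSums

open Finset in
theorem sum_Ico_rpow_neg_le {m : ℕ} (hm : 0 < m) (n : ℕ) {σ : ℝ} (hσ : 1 < σ) :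
    ∑ j ∈ Ico m n, (j : ℝ) ^ (-σ) ≤ (m : ℝ) ^ (-σ) + (m : ℝ) ^ (1 - σ) / (σ - 1) := by
  have hm' : (0 : ℝ) < m := by exact_mod_cast hm
  have : 0 < σ - 1 := sub_pos.2 hσ
  rcases le_or_gt n m with hnm | hmn
  · rw [Ico_eq_empty_of_le hnm, sum_empty]
    positivity
  obtain ⟨n, rfl⟩ : ∃ k, n = k + 1 := ⟨n - 1, by omega⟩
  have hmn : m ≤ n := Nat.le_of_lt_succ hmn
  have hanti : AntitoneOn (fun x : ℝ => x ^ (-σ)) (Set.Icc m n) := fun x hx y _ hxy =>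
    Real.rpow_le_rpow_of_nonpos (hm'.trans_le hx.1) hxy (by linarith)
  have hintegral : ∫ x in (m : ℝ)..n, x ^ (-σ) =
      (m : ℝ) ^ (1 - σ) / (σ - 1) - (n : ℝ) ^ (1 - σ) / (σ - 1) := by
    rw [integral_rpow (Or.inr ⟨by linarith, fun h => ?_⟩), neg_add_eq_sub, ← neg_sub σ 1, div_neg,
      sub_div, neg_sub]
    rw [Set.uIcc_of_le (by exact_mod_cast hmn)] at h
    exact hm'.not_ge h.1
  have hsum := hanti.sum_le_integral_Ico hmn
  have hn : 0 ≤ (n : ℝ) ^ (1 - σ) / (σ - 1) := by positivity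
  rw [sum_eq_sum_Ico_succ_bot (Nat.lt_succ_of_le hmn), ← sum_Ico_add' _ m n 1]
  linarith

/-- An upper bound for the sum of `n ^ (-σ)` over the integers `n ≥ P`. -/
noncomputable def tailBound (P σ : ℝ) : ℝ :=
  (1 + P / (σ - 1)) / P ^ σ

variable {P σ : ℝ}

theorem tailBound_eq (hP : 0 < P) (σ : ℝ) :
    tailBound P σ = P ^ (-σ) + P ^ (1 - σ) / (σ - 1) := by
  rw [tailBound, Real.rpow_neg hP.le, Real.rpow_sub hP, Real.rpow_one]
  ring

theorem tailBound_add_le_half (hP : 2 ≤ P) (hσ : 1 < σ) {s : ℝ} (hs : 1 ≤ s) :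
    tailBound P (σ + s) ≤ tailBound P σ / 2 := by
  have hP₀ : 0 < P := by linarith
  have : 0 < σ - 1 := by linarith
  have hpow : 2 ≤ P ^ s := calc
    2 ≤ P := hP
    _ = P ^ (1 : ℝ) := (Real.rpow_one P).symm
    _ ≤ P ^ s := Real.rpow_le_rpow_of_exponent_le (by linarith) hs
  calc tailBound P (σ + s) = (1 + P / (σ + s - 1)) / (P ^ σ * P ^ s) := by
        rw [tailBound, Real.rpow_add hP₀]
    _ ≤ (1 + P / (σ - 1)) / (P ^ σ * 2) := by gcongr; linarith
    _ = tailBound P σ / 2 := by rw [tailBound, div_div]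

theorem summable_rpow_neg_nat_ge (P : ℝ) (hσ : 1 < σ) :
    Summable fun n : {n : ℕ // P ≤ n} => (n : ℝ) ^ (-σ) :=
  (Real.summable_nat_rpow.2 (neg_lt_neg hσ)).comp_injective Subtype.val_injective

theorem tsum_rpow_neg_nat_ge_le (hP : 0 < P) (hσ : 1 < σ) :
    ∑' n : {n : ℕ // P ≤ n}, (n : ℝ) ^ (-σ) ≤ tailBound P σ := by
  refine (summable_rpow_neg_nat_ge P hσ).tsum_le_of_sum_le fun s => ?_
  have hceil : P ≤ (⌈P⌉₊ : ℝ) := Nat.le_ceil P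
  have : 0 < σ - 1 := sub_pos.2 hσ
  have hsubset : s.map (Function.Embedding.subtype _) ⊆
      Finset.Ico ⌈P⌉₊ ((s.map (Function.Embedding.subtype _)).sup id + 1) := fun n hn => by
    obtain ⟨⟨n, hPn⟩, -, rfl⟩ := Finset.mem_map.1 hn
    exact Finset.mem_Ico.2 ⟨Nat.ceil_le.2 hPn, Nat.lt_succ_of_le (Finset.le_sup (f := id) hn)⟩
  calc ∑ n ∈ s, (n : ℝ) ^ (-σ)
      = ∑ n ∈ s.map (Function.Embedding.subtype _), (n : ℝ) ^ (-σ) := by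
        rw [Finset.sum_map]
        rfl
    _ ≤ ∑ n ∈ Finset.Ico ⌈P⌉₊ _, (n : ℝ) ^ (-σ) :=
        Finset.sum_le_sum_of_subset_of_nonneg hsubset fun _ _ _ => by positivity
    _ ≤ (⌈P⌉₊ : ℝ) ^ (-σ) + (⌈P⌉₊ : ℝ) ^ (1 - σ) / (σ - 1) :=
        sum_Ico_rpow_neg_le (Nat.ceil_pos.2 hP) _ hσ
    _ ≤ P ^ (-σ) + P ^ (1 - σ) / (σ - 1) := by
        gcongr ?_ + ?_ / _ <;> exact Real.rpow_le_rpow_of_nonpos hP hceil (by linarith)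
    _ = tailBound P σ := (tailBound_eq hP σ).symm

theorem rpow_neg_mem_Ioo {p : ℕ} (hp : p.Prime) (hσ : 0 < σ) :
    (p : ℝ) ^ (-σ) ∈ Set.Ioo (0 : ℝ) 1 :=
  ⟨Real.rpow_pos_of_pos (by exact_mod_cast hp.pos) _,
    Real.rpow_lt_one_of_one_lt_of_neg (by exact_mod_cast hp.one_lt) (neg_lt_zero.2 hσ)⟩

theorem zetaFactor_pos {p : ℕ} (hp : p.Prime) (hσ : 0 < σ) : 0 < zetaFactor σ p :=
  inv_pos.2 (sub_pos.2 (rpow_neg_mem_Ioo hp hσ).2)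

theorem log_zetaFactor_nonneg {p : ℕ} (hp : p.Prime) (hσ : 0 < σ) :
    0 ≤ Real.log (zetaFactor σ p) := by
  obtain ⟨hpos, hlt⟩ := rpow_neg_mem_Ioo hp hσ
  exact Real.log_nonneg ((one_le_inv₀ (sub_pos.2 hlt)).2 (sub_le_self 1 hpos.le))

theorem log_zetaFactor_le_tsum {p : ℕ} (hp : p.Prime) (hσ : 0 < σ) :
    Real.log (zetaFactor σ p) ≤ ∑' k : ℕ, ((p : ℝ) ^ (-σ)) ^ (k + 1) := by
  obtain ⟨hpos, hlt⟩ := rpow_neg_mem_Ioo hp hσ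
  have hgeom := (summable_geometric_of_lt_one hpos.le hlt).tsum_eq_zero_add
  rw [tsum_geometric_of_lt_one hpos.le hlt, pow_zero] at hgeom
  linarith [Real.log_le_sub_one_of_pos (zetaFactor_pos hp hσ), zetaFactor.eq_1 σ p]

/-- The prime power `p ^ (k + 1)`, among the integers `≥ P`. -/
def primePowGE (P : ℝ) (x : PrimeGE P × ℕ) : {n : ℕ // P ≤ n} :=
  ⟨x.1.1 ^ (x.2 + 1), x.1.2.2.trans (by exact_mod_cast Nat.le_self_pow (Nat.succ_ne_zero _) _)⟩

theorem primePowGE_injective (P : ℝ) : Function.Injective (primePowGE P) := by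
  rintro ⟨⟨p, hp, _⟩, k⟩ ⟨⟨r, hr, _⟩, l⟩ h
  have hpow : p ^ (k + 1) = r ^ (l + 1) := congrArg Subtype.val h
  have hpr : ((⟨p, hp⟩, k) : Nat.Primes × ℕ) = (⟨r, hr⟩, l) :=
    Nat.Primes.prodNatEquiv.injective (Subtype.ext hpow)
  cases hpr
  rfl

theorem primePowGE_rpow_neg (σ : ℝ) (x : PrimeGE P × ℕ) :
    (primePowGE P x : ℝ) ^ (-σ) = ((x.1 : ℝ) ^ (-σ)) ^ (x.2 + 1) := by
  simp only [primePowGE, Nat.cast_pow]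
  exact (Real.rpow_pow_comm (Nat.cast_nonneg _) _ _).symm

theorem summable_primePow_rpow_neg (P : ℝ) (hσ : 1 < σ) :
    Summable fun x : PrimeGE P × ℕ => ((x.1 : ℝ) ^ (-σ)) ^ (x.2 + 1) :=
  ((summable_rpow_neg_nat_ge P hσ).comp_injective (primePowGE_injective P)).congr
    (primePowGE_rpow_neg σ)

theorem summable_log_zetaFactor (P : ℝ) (hσ : 1 < σ) :
    Summable fun p : PrimeGE P => Real.log (zetaFactor σ p.1) :=
  .of_nonneg_of_le (fun p => log_zetaFactor_nonneg p.2.1 (by linarith))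
    (fun p => log_zetaFactor_le_tsum p.2.1 (by linarith)) (summable_primePow_rpow_neg P hσ).prod

theorem tsum_log_zetaFactor_le (hP : 0 < P) (hσ : 1 < σ) :
    ∑' p : PrimeGE P, Real.log (zetaFactor σ p.1) ≤ tailBound P σ := by
  have hpow := summable_primePow_rpow_neg P hσ
  calc ∑' p : PrimeGE P, Real.log (zetaFactor σ p.1)
      ≤ ∑' p : PrimeGE P, ∑' k : ℕ, ((p : ℝ) ^ (-σ)) ^ (k + 1) :=
        (summable_log_zetaFactor P hσ).tsum_le_tsum
          (fun p => log_zetaFactor_le_tsum p.2.1 (by linarith)) hpow.prod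
    _ = ∑' x : PrimeGE P × ℕ, ((x.1 : ℝ) ^ (-σ)) ^ (x.2 + 1) := hpow.tsum_prod.symm
    _ ≤ ∑' n : {n : ℕ // P ≤ n}, (n : ℝ) ^ (-σ) :=
        hpow.tsum_le_tsum_of_inj _ (primePowGE_injective P) (fun _ _ => by positivity)
          (fun x => (primePowGE_rpow_neg σ x).ge) (summable_rpow_neg_nat_ge P hσ)
    _ ≤ tailBound P σ := tsum_rpow_neg_nat_ge_le hP hσ

end PrimeSums

section Classes

variable {G : Type} [CommGroup G]

/-- The lattice-invariant class of `u`: the generators of the cyclic subgroup generated by `u`. -/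
def classOf (u : G) : LatticeClass G :=
  classEquiv.symm ⟨Subgroup.zpowers u, inferInstance⟩

theorem closure_classOf (u : G) : Subgroup.closure (classOf u).1 = Subgroup.zpowers u :=
  congrArg Subtype.val (classEquiv.apply_symm_apply _)

theorem mem_iff_eq_classOf (u : G) (A : LatticeClass G) : u ∈ A.1 ↔ A = classOf u := by
  refine ⟨fun hu => ?_, fun h => h ▸ (rfl : Subgroup.zpowers u = Subgroup.zpowers u)⟩
  obtain ⟨_, K, hK, rfl⟩ := A
  obtain rfl : Subgroup.zpowers u = K := hu
  rfl

/-- The combination `∑_A |G/G₀⟨A⟩| W_A(|G₀⟨A⟩/G₀|)` over the lattice-invariant classes `A`: both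
the vectors `Γ_s(t)` and their local factors are of this form. -/
noncomputable def relIndexSum [Finite G] (G₀ : Subgroup G) (W : ℕ → LatticeClass G → ℝ) : ℝ :=
  ∑ A, ((G₀ ⊔ Subgroup.closure A.1).index : ℝ) *
    W (G₀.relIndex (G₀ ⊔ Subgroup.closure A.1)) A

theorem hasSum_relIndexSum [Finite G] {ι : Type*} (G₀ : Subgroup G)
    {w : ι → ℕ → LatticeClass G → ℝ} {W : ℕ → LatticeClass G → ℝ}
    (h : ∀ f, 0 < f → ∀ A, HasSum (fun i => w i f A) (W f A)) :
    HasSum (fun i => relIndexSum G₀ (w i)) (relIndexSum G₀ W) :=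
  hasSum_sum fun A _ =>
    (h _ (Nat.pos_of_ne_zero Subgroup.FiniteIndex.index_ne_zero) A).mul_left _

end Classes

section LogZeta

variable {q : ℕ}

/-- The prime `p` has its residue modulo `q` in the class `A`. -/
def InClass (A : LatticeClass (ZMod q)ˣ) (p : ℕ) : Prop :=
  ∃ a ∈ A.1, (a : ZMod q) = (p : ZMod q)

theorem inClass_iff_eq_classOf {p : ℕ} {u : (ZMod q)ˣ} (hu : (u : ZMod q) = p)
    (A : LatticeClass (ZMod q)ˣ) : InClass A p ↔ A = classOf u := by
  rw [← mem_iff_eq_classOf]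
  exact ⟨fun ⟨a, ha, hap⟩ => Units.ext (hap.trans hu.symm) ▸ ha, fun h => ⟨u, h, hu⟩⟩

theorem not_inClass {p : ℕ} (hp : ¬ IsUnit (p : ZMod q)) (A : LatticeClass (ZMod q)ˣ) :
    ¬ InClass A p :=
  fun ⟨a, _, ha⟩ => hp ⟨a, ha⟩

variable {P σ : ℝ}

/-- Inclusion of the primes `p ≥ P` with residue in `A` into the primes `p ≥ P`. -/
def primeGEInEmbedding (P : ℝ) (A : Set (ZMod q)ˣ) : PrimeGEIn P q A ↪ PrimeGE P :=
  Subtype.impEmbedding _ _ fun _ h => ⟨h.1, h.2.1⟩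

theorem summable_log_zetaFactor_primeGEIn (P : ℝ) (A : Set (ZMod q)ˣ) (hσ : 1 < σ) :
    Summable fun p : PrimeGEIn P q A => Real.log (zetaFactor σ p.1) := by
  have h := (summable_log_zetaFactor P hσ).comp_injective (primeGEInEmbedding P A).injective
  exact h

theorem multipliable_zetaFactor (P : ℝ) (A : Set (ZMod q)ˣ) (hσ : 1 < σ) :
    Multipliable fun p : PrimeGEIn P q A => zetaFactor σ p.1 :=
  Real.multipliable_of_summable_log (fun p => zetaFactor_pos p.2.1 (by linarith))
    (summable_log_zetaFactor_primeGEIn P A hσ)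

open Classical in
theorem hasSum_VVec (P : ℝ) (A : LatticeClass (ZMod q)ˣ) (hσ : 1 < σ) :
    HasSum (fun p : PrimeGE P => if InClass A p.1 then Real.log (zetaFactor σ p.1) else 0)
      (VVec q P σ A) := by
  have hsummable := summable_log_zetaFactor_primeGEIn P A.1 hσ
  have hlog : VVec q P σ A = ∑' p : PrimeGEIn P q A.1, Real.log (zetaFactor σ p.1) := by
    rw [VVec, zetaP, ← Real.rexp_tsum_eq_tprod (fun p => zetaFactor_pos p.2.1 (by linarith))
      hsummable, Real.log_exp]
  rw [hlog, ← (primeGEInEmbedding P A.1).injective.hasSum_iff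
    fun p hp => if_neg fun h : InClass A p => hp ⟨⟨p.1, p.2.1, p.2.2, h⟩, rfl⟩]
  convert hsummable.hasSum using 2 with p
  exact if_pos p.2.2.2

theorem VVec_nonneg (P : ℝ) (A : LatticeClass (ZMod q)ˣ) (hσ : 1 < σ) : 0 ≤ VVec q P σ A := by
  classical
  refine (hasSum_VVec P A hσ).nonneg fun p => ?_
  split_ifs
  exacts [log_zetaFactor_nonneg p.2.1 (by linarith), le_rfl]

theorem one_lt_natCast_mul {n : ℕ} (hn : 0 < n) (hσ : 1 < σ) : 1 < n * σ :=
  one_lt_mul_of_le_of_lt (by exact_mod_cast hn) hσ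

open Classical in
theorem hasSum_relIndexSum_log_zetaFactor (P : ℝ) (G₀ : Subgroup (ZMod q)ˣ) (hσ : 1 < σ) :
    HasSum (fun p : PrimeGE P => relIndexSum G₀ fun f A =>
        if InClass A p then Real.log (zetaFactor (f * σ) p) else 0)
      (relIndexSum G₀ fun f => VVec q P (f * σ)) :=
  hasSum_relIndexSum G₀ fun _ hf A => hasSum_VVec P A (one_lt_natCast_mul hf hσ)

variable [NeZero q]

theorem sum_VVec_le (hP : 0 < P) (hσ : 1 < σ) : ∑ A, VVec q P σ A ≤ tailBound P σ := by
  classical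
  refine (hasSum_le (fun p => ?_) (hasSum_sum fun A _ => hasSum_VVec P A hσ)
    (summable_log_zetaFactor P hσ).hasSum).trans (tsum_log_zetaFactor_le hP hσ)
  by_cases hp : IsUnit (p : ZMod q)
  · obtain ⟨u, hu⟩ := hp
    simp [inClass_iff_eq_classOf hu]
  · simpa [not_inClass hp] using log_zetaFactor_nonneg p.2.1 (by linarith)

end LogZeta

section LProducts

theorem multipliable_inv_one_sub_of_summable {ι K : Type*} [NormedField K] [CompleteSpace K]
    {f : ι → K} (hf : Summable fun i => ‖f i‖) : Multipliable fun i => (1 - f i)⁻¹ := by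
  have hsmall : ∀ᶠ i in Filter.cofinite, ‖f i‖ < 1 / 2 :=
    hf.tendsto_cofinite_zero.eventually (gt_mem_nhds one_half_pos)
  have hbound : ∀ᶠ i in Filter.cofinite, ‖‖(1 - f i)⁻¹ - 1‖‖ ≤ 2 * ‖f i‖ := by
    filter_upwards [hsmall] with i hi
    have hnorm : 1 / 2 ≤ ‖1 - f i‖ := by
      have := norm_sub_norm_le 1 (f i)
      rw [norm_one] at this
      linarith
    have hne : 1 - f i ≠ 0 := norm_pos_iff.1 (by linarith)
    have hdiff : (1 - f i)⁻¹ - 1 = f i / (1 - f i) := by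
      field_simp
      ring
    rw [norm_norm, hdiff, norm_div, div_le_iff₀ (by linarith)]
    nlinarith [norm_nonneg (f i)]
  simpa using multipliable_one_add_of_summable
    ((hf.mul_left 2).of_norm_bounded_eventually hbound)

variable {q : ℕ} (χ : DirichletCharacter ℂ q) {P σ : ℝ}

theorem LFactor_ofReal (σ : ℝ) (p : ℕ) :
    LFactor χ σ p = (1 - χ p * ((p : ℝ) ^ (-σ) : ℝ))⁻¹ := by
  rw [LFactor, div_eq_mul_inv, Complex.ofReal_cpow (Nat.cast_nonneg p), Complex.ofReal_neg,
    Complex.cpow_neg, Complex.ofReal_natCast]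

theorem multipliable_LFactor (P : ℝ) (hσ : 1 < σ) :
    Multipliable fun p : PrimeGE P => LFactor χ σ p.1 := by
  simp_rw [LFactor_ofReal]
  have hsummable : Summable fun p : PrimeGE P => (p : ℝ) ^ (-σ) :=
    (Real.summable_nat_rpow.2 (neg_lt_neg hσ)).comp_injective Subtype.val_injective
  refine multipliable_inv_one_sub_of_summable
    (.of_nonneg_of_le (fun _ => norm_nonneg _) (fun p => ?_) hsummable)
  have hpos : (0 : ℝ) ≤ (p : ℝ) ^ (-σ) := by positivity
  rw [norm_mul, Complex.norm_of_nonneg hpos]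
  exact mul_le_of_le_one_left hpos (χ.norm_le_one _)

variable [NeZero q] (G₀ : Subgroup (ZMod q)ˣ)

theorem prod_perp_LFactor_of_isUnit {u : (ZMod q)ˣ} {p : ℕ} (hu : (u : ZMod q) = p) (σ : ℝ) :
    ∏ χ ∈ perp G₀, LFactor χ σ p =
      (zetaFactor (G₀.relIndex (G₀ ⊔ Subgroup.zpowers u) * σ) p ^
        (G₀ ⊔ Subgroup.zpowers u).index : ℝ) := by
  have hpow (n : ℕ) : ((p : ℝ) ^ (-σ)) ^ n = (p : ℝ) ^ (-(n * σ)) := by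
    rw [← Real.rpow_mul_natCast (Nat.cast_nonneg p), neg_mul, mul_comm]
  simp_rw [LFactor_ofReal, Finset.prod_inv_distrib, ← hu, prod_perp_one_sub, zetaFactor, ← hpow]
  push_cast
  rw [inv_pow]

open Classical in
theorem prod_perp_LFactor (hσ : 0 < σ) {p : ℕ} (hp : p.Prime) :
    ∏ χ ∈ perp G₀, LFactor χ σ p = Real.exp (relIndexSum G₀ fun f A =>
      if InClass A p then Real.log (zetaFactor (f * σ) p) else 0) := by
  by_cases hunit : IsUnit (p : ZMod q)
  · obtain ⟨u, hu⟩ := hunit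
    have hpos : 0 < zetaFactor (G₀.relIndex (G₀ ⊔ Subgroup.zpowers u) * σ) p :=
      zetaFactor_pos hp (mul_pos (Nat.cast_pos.2 (Nat.pos_of_ne_zero
        Subgroup.FiniteIndex.index_ne_zero)) hσ)
    simp_rw [relIndexSum, inClass_iff_eq_classOf hu, mul_ite, mul_zero]
    rw [Finset.sum_ite_eq' Finset.univ (classOf u), if_pos (Finset.mem_univ _), closure_classOf,
      Real.exp_nat_mul, Real.exp_log hpos, prod_perp_LFactor_of_isUnit G₀ hu]
  · have hzero (χ : DirichletCharacter ℂ q) : χ (p : ZMod q) = 0 := χ.map_nonunit hunit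
    simp [relIndexSum, LFactor_ofReal, not_inClass hunit, hzero]

theorem prod_perp_LP (P : ℝ) (hσ : 1 < σ) :
    ∏ χ ∈ perp G₀, LP P σ χ = Real.exp (relIndexSum G₀ fun f => VVec q P (f * σ)) := by
  have hfactor (p : PrimeGE P) := prod_perp_LFactor G₀ (zero_lt_one.trans hσ) p.2.1
  simp_rw [LP]
  rw [← Multipliable.tprod_finsetProd fun χ _ => multipliable_LFactor χ P hσ]
  simp_rw [hfactor]
  have hexp := (hasSum_relIndexSum_log_zetaFactor P G₀ hσ).rexp.map Complex.ofRealHom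
    Complex.continuous_ofReal
  exact hexp.tprod_eq

variable {s : ℝ} {t : ℕ}

theorem LProd_eq_exp (P : ℝ) (hs : 1 < s) (ht : 0 < t) :
    LProd P s G₀ t = Real.exp (relIndexSum G₀ fun f => VVec q P (f * (t * s))) :=
  prod_perp_LP G₀ P (one_lt_natCast_mul ht hs)

theorem gammaS_eq_relIndexSum (P : ℝ) (hs : 1 < s) (ht : 0 < t) :
    gammaS P s G₀ t = relIndexSum G₀ fun f => VVec q P (f * (t * s)) := by
  rw [gammaS, LProd_eq_exp G₀ P hs ht, Complex.ofReal_re, Real.log_exp]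

end LProducts

section Inversion

variable {G : Type} [CommGroup G] [Finite G]

theorem isCyclic_closure {G : Type} [CommGroup G] (A : LatticeClass G) :
    IsCyclic (Subgroup.closure A.1) :=
  (classEquiv A).2

theorem relIndex_sup_mem_divisors_exponent (K : Subgroup G) {B : Subgroup G} (hB : IsCyclic B) :
    K.relIndex (K ⊔ B) ∈ (Monoid.exponent G).divisors := by
  rw [Nat.mem_divisors, Subgroup.relIndex_sup_left]
  refine ⟨(Subgroup.relIndex_dvd_card _ _).trans ?_, Monoid.exponent_ne_zero_of_finite⟩
  rw [← IsCyclic.exponent_eq_card]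
  exact Monoid.exponent_submonoid_dvd B.toSubmonoid

theorem index_inv_mul_index_of_le {H K : Subgroup G} (h : H ≤ K) :
    (H.index : ℝ)⁻¹ * K.index = (H.relIndex K : ℝ)⁻¹ := by
  have hK : (K.index : ℝ) ≠ 0 := Nat.cast_ne_zero.2 Subgroup.FiniteIndex.index_ne_zero
  rw [← Subgroup.relIndex_mul_index h, Nat.cast_mul, mul_inv, inv_mul_cancel_right₀ hK]

open Classical in
theorem M1Inv_mulVec_apply (v : Subgroup G → ℝ) (A : LatticeClass G) :
    (M1Inv *ᵥ fun K => v K.1) A = ∑ K : Subgroup G with K ≤ Subgroup.closure A.1,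
      (ArithmeticFunction.moebius (K.relIndex (Subgroup.closure A.1)) : ℝ) *
        ((K.index : ℝ)⁻¹ * v K) := by
  simp only [Matrix.mulVec, dotProduct, M1Inv, ite_mul, zero_mul, ← Finset.sum_filter,
    div_eq_inv_mul]
  refine Finset.sum_bij (fun K _ => K.1) (fun K hK => ?_) (fun _ _ _ _ => Subtype.ext)
    (fun K hK => ?_) fun K _ => ?_
  · simpa using hK
  · have hle : K ≤ Subgroup.closure A.1 := (Finset.mem_filter.1 hK).2
    have := isCyclic_closure A
    exact ⟨⟨K, Subgroup.isCyclic_of_le hle⟩, by simpa using hle, rfl⟩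
  · ring

open Classical in
theorem smul_NClass_mulVec_apply (d : ℕ) (c : ℝ) (v : LatticeClass G → ℝ) (A : LatticeClass G) :
    ((c • NClass d) *ᵥ v) A = ∑ K : Subgroup G with K ≤ Subgroup.closure A.1,
      ∑ B, if K.relIndex (K ⊔ Subgroup.closure B.1) = d then
        (ArithmeticFunction.moebius (K.relIndex (Subgroup.closure A.1)) : ℝ) * (c * v B)
      else 0 := by
  rw [Finset.sum_comm]
  refine Finset.sum_congr rfl fun B _ => ?_
  change c * N d (classEquiv A) (classEquiv B) * v B = _
  rw [N, ← Finset.filter_filter, Finset.sum_filter, mul_right_comm, mul_comm, Finset.sum_mul]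
  exact Finset.sum_congr rfl fun K _ => ite_zero_mul _ _ _

theorem M1Inv_mulVec_relIndexSum (W : ℕ → LatticeClass G → ℝ) :
    M1Inv *ᵥ (fun K => relIndexSum K.1 W) =
      ∑ d ∈ (Monoid.exponent G).divisors, ((d : ℝ)⁻¹ • NClass d) *ᵥ W d := by
  classical
  funext A
  rw [M1Inv_mulVec_apply (relIndexSum · W), Finset.sum_apply]
  simp_rw [smul_NClass_mulVec_apply]
  rw [Finset.sum_comm]
  refine Finset.sum_congr rfl fun K _ => ?_
  rw [Finset.sum_comm, relIndexSum, Finset.mul_sum, Finset.mul_sum]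
  refine Finset.sum_congr rfl fun B _ => ?_
  rw [Finset.sum_ite_eq, if_pos (relIndex_sup_mem_divisors_exponent K (isCyclic_closure B)),
    ← mul_assoc (K.index : ℝ)⁻¹, index_inv_mul_index_of_le le_sup_left]

theorem NClass_one : NClass (G := G) 1 = 1 := by
  rw [NClass, N_one, Matrix.reindex_apply, Matrix.submatrix_one_equiv]

theorem abs_inv_smul_NClass_le {d : ℕ} (hd : d ≠ 0) (A B : LatticeClass G) :
    |((d : ℝ)⁻¹ • NClass d) A B| ≤ (d : ℝ)⁻¹ := by
  rw [Matrix.smul_apply, smul_eq_mul, abs_mul, abs_of_nonneg (by positivity)]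
  exact mul_le_of_le_one_right (by positivity) (abs_N_le_one (classEquiv A) (classEquiv B) hd)

end Inversion

section Recursion

variable {q : ℕ} [NeZero q] {s : ℝ} {t : ℕ}

theorem M1Inv_mulVec_GammaVec (P : ℝ) (hs : 1 < s) (ht : 0 < t) :
    M1Inv *ᵥ GammaVec q P s t = VVec q P (t * s) +
      ∑ d ∈ (Monoid.exponent (ZMod q)ˣ).divisors.erase 1,
        ((d : ℝ)⁻¹ • NClass d) *ᵥ VVec q P ((t * d : ℕ) * s) := by
  have hGamma : GammaVec q P s t =
      fun K => relIndexSum K.1 fun d => VVec q P ((t * d : ℕ) * s) := by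
    funext K
    simp only [GammaVec, gammaS_eq_relIndexSum K.1 P hs ht, Nat.cast_mul, mul_left_comm, mul_assoc]
  rw [hGamma, M1Inv_mulVec_relIndexSum, ← Finset.add_sum_erase _ _
    (Nat.one_mem_divisors.2 Monoid.exponent_ne_zero_of_finite), NClass_one]
  simp only [Nat.cast_one, inv_one, one_smul, Matrix.one_mulVec, mul_one]

end Recursion

section TruncatedInversion

/-- The tuples `(d₁, …, d_v)` of elements of `S` with `d₁ ⋯ d_v ≤ z`; `divisorTuples` is the case
where `S` consists of the divisors of `exp G` other than `1`. -/
def tuplesLE (S : Finset ℕ) (v z : ℕ) : Finset (Fin v → ℕ) :=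
  (Fintype.piFinset fun _ : Fin v => S).filter fun d => ∏ i, d i ≤ z

/-- The ordered product `A_{d₁} ⋯ A_{d_v}`. -/
def tupleProd {M : Type*} [Monoid M] (A : ℕ → M) {v : ℕ} (d : Fin v → ℕ) : M :=
  (List.ofFn fun i => A (d i)).prod

variable {S : Finset ℕ}

theorem mem_tuplesLE {v z : ℕ} {d : Fin v → ℕ} :
    d ∈ tuplesLE S v z ↔ (∀ i, d i ∈ S) ∧ ∏ i, d i ≤ z := by
  simp only [tuplesLE, Finset.mem_filter, Fintype.mem_piFinset]

theorem tupleProd_snoc {M : Type*} [Monoid M] (A : ℕ → M) {v : ℕ} (d : Fin v → ℕ) (e : ℕ) :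
    tupleProd A (Fin.snoc d e : Fin (v + 1) → ℕ) = tupleProd A d * A e := by
  rw [tupleProd, List.ofFn_succ', List.concat_eq_append, List.prod_append]
  simp [tupleProd]

theorem forall_snoc_mem {v : ℕ} {d : Fin v → ℕ} (hd : ∀ i, d i ∈ S) {e : ℕ} (he : e ∈ S)
    (i : Fin (v + 1)) : (Fin.snoc d e : Fin (v + 1) → ℕ) i ∈ S := by
  refine Fin.lastCases ?_ (fun j => ?_) i
  · simpa using he
  · simpa using hd j

theorem sum_tuplesLE_succ (hS : ∀ e ∈ S, 0 < e) {E : Type*} [AddCommMonoid E] (v z : ℕ)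
    (F : (Fin (v + 1) → ℕ) → E) :
    ∑ d ∈ tuplesLE S (v + 1) z, F d =
      ∑ d ∈ tuplesLE S v z, ∑ e ∈ S with (∏ i, d i) * e ≤ z, F (Fin.snoc d e) := by
  rw [Finset.sum_sigma']
  refine (Finset.sum_bij (fun x _ => Fin.snoc x.1 x.2) ?_ ?_ ?_ fun _ _ => rfl).symm
  · rintro ⟨d, e⟩ h
    simp only [Finset.mem_sigma, mem_tuplesLE, Finset.mem_filter] at h
    exact mem_tuplesLE.2 ⟨forall_snoc_mem h.1.1 h.2.1, (Fin.prod_snoc e d).trans_le h.2.2⟩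
  · rintro ⟨d, e⟩ _ ⟨d', e'⟩ _ h
    obtain ⟨rfl, rfl⟩ := Fin.snoc_injective2 h
    rfl
  · intro d hd
    rw [mem_tuplesLE, Fin.prod_univ_castSucc] at hd
    refine ⟨⟨Fin.init d, d (Fin.last v)⟩, ?_, Fin.snoc_init_self d⟩
    simp only [Finset.mem_sigma, mem_tuplesLE, Finset.mem_filter]
    exact ⟨⟨fun i => hd.1 _, (Nat.le_mul_of_pos_right _ (hS _ (hd.1 _))).trans hd.2⟩, hd.1 _, hd.2⟩

variable {ι R : Type*} [Fintype ι] [DecidableEq ι] [CommRing R]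

/-- The term `A_{d₁} ⋯ A_{d_v} V(d₁ ⋯ d_v)` of the iterated recursion. -/
def tupleVec (A : ℕ → Matrix ι ι R) (V : ℕ → ι → R) {v : ℕ} (d : Fin v → ℕ) : ι → R :=
  tupleProd A d *ᵥ V (∏ i, d i)

/-- The sum over `v < k` of `(-1)^v` times the sum of `A_{d₁} ⋯ A_{d_v} W(d₁ ⋯ d_v)` over the
tuples of elements of `S` with `d₁ ⋯ d_v ≤ z`. -/
def truncatedInversion (S : Finset ℕ) (A : ℕ → Matrix ι ι R) (W : ℕ → ι → R) (k z : ℕ) : ι → R :=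
  ∑ v ∈ Finset.range k, (-1 : R) ^ v • ∑ d ∈ tuplesLE S v z, tupleVec A W d

variable {A : ℕ → Matrix ι ι R} {V W : ℕ → ι → R}

theorem tupleVec_eq_add_sum_snoc (hS : ∀ e ∈ S, 0 < e)
    (hW : ∀ t, 0 < t → W t = V t + ∑ e ∈ S, A e *ᵥ V (t * e)) {v : ℕ} {d : Fin v → ℕ}
    (hd : ∀ i, d i ∈ S) :
    tupleVec A W d =
      tupleVec A V d + ∑ e ∈ S, tupleVec A V (Fin.snoc d e : Fin (v + 1) → ℕ) := by
  rw [tupleVec, hW _ (Finset.prod_pos fun i _ => hS _ (hd i)), Matrix.mulVec_add,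
    Matrix.mulVec_sum]
  simp only [tupleVec, tupleProd_snoc, Fin.prod_snoc, Matrix.mulVec_mulVec]

theorem sum_tupleVec_snoc (hS : ∀ e ∈ S, 0 < e) (v z : ℕ) :
    ∑ d ∈ tuplesLE S v z, ∑ e ∈ S, tupleVec A V (Fin.snoc d e : Fin (v + 1) → ℕ) =
      ∑ d ∈ tuplesLE S (v + 1) z, tupleVec A V d +
        ∑ d ∈ tuplesLE S v z, ∑ e ∈ S with ¬ (∏ i, d i) * e ≤ z,
          tupleVec A V (Fin.snoc d e : Fin (v + 1) → ℕ) := by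
  simp_rw [sum_tuplesLE_succ hS, ← Finset.sum_add_distrib, Finset.sum_filter_add_sum_filter_not]

theorem sub_truncatedInversion (hS : ∀ e ∈ S, 0 < e)
    (hW : ∀ t, 0 < t → W t = V t + ∑ e ∈ S, A e *ᵥ V (t * e)) {z : ℕ} (hz : 1 ≤ z) (k : ℕ) :
    V 1 - truncatedInversion S A W (k + 1) z =
      (-1 : R) ^ (k + 1) • ∑ d ∈ tuplesLE S k z, ∑ e ∈ S,
        tupleVec A V (Fin.snoc d e : Fin (k + 1) → ℕ) -
      ∑ v ∈ Finset.range k, (-1 : R) ^ v • ∑ d ∈ tuplesLE S v z,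
        ∑ e ∈ S with ¬ (∏ i, d i) * e ≤ z, tupleVec A V (Fin.snoc d e : Fin (v + 1) → ℕ) := by
  have hsum (v : ℕ) : ∑ d ∈ tuplesLE S v z, tupleVec A W d =
      ∑ d ∈ tuplesLE S v z, tupleVec A V d + ∑ d ∈ tuplesLE S v z, ∑ e ∈ S,
        tupleVec A V (Fin.snoc d e : Fin (v + 1) → ℕ) := by
    rw [← Finset.sum_add_distrib]
    exact Finset.sum_congr rfl fun d hd => tupleVec_eq_add_sum_snoc hS hW (mem_tuplesLE.1 hd).1
  simp_rw [truncatedInversion, hsum]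
  induction k with
  | zero =>
    have htuples : tuplesLE S 0 z = {Fin.elim0} := by
      ext d
      simp [mem_tuplesLE, Subsingleton.elim d Fin.elim0, hz]
    have hvec : tupleVec A V Fin.elim0 = V 1 := by simp [tupleVec, tupleProd]
    simp [htuples, hvec]
  | succ k ih =>
    rw [Finset.sum_range_succ _ (k + 1), ← sub_sub, ih, sum_tupleVec_snoc hS k z,
      Finset.sum_range_succ _ k, pow_succ (-1 : R) (k + 1), pow_succ (-1 : R) k]
    module

end TruncatedInversion

section Estimates

variable {S : Finset ℕ}

theorem two_pow_le_prod (hS : ∀ e ∈ S, 2 ≤ e) {v : ℕ} {d : Fin v → ℕ} (hd : ∀ i, d i ∈ S) :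
    2 ^ v ≤ ∏ i, d i := by
  simpa using Finset.pow_card_le_prod Finset.univ d 2 fun i _ => hS _ (hd i)

theorem sum_inv_le (hS : ∀ e ∈ S, 2 ≤ e) : ∑ e ∈ S, (e : ℝ)⁻¹ ≤ ((S.card : ℝ) + 1) / 3 := by
  have hterm (e : ℕ) (he : e ∈ S) : (e : ℝ)⁻¹ ≤ 1 / 3 + if e = 2 then 1 / 6 else 0 := by
    split_ifs with h
    · norm_num [h]
    · have hthree : (3 : ℝ) ≤ e := by exact_mod_cast (hS e he).lt_of_ne' h
      rw [add_zero, one_div]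
      gcongr
  refine (Finset.sum_le_sum hterm).trans ?_
  rw [Finset.sum_add_distrib, Finset.sum_const, nsmul_eq_mul, Finset.sum_ite_eq']
  split_ifs <;> linarith

theorem sum_inv_mul_quarter_pow_le (hS : ∀ e ∈ S, 2 ≤ e) :
    ∑ e ∈ S, (e : ℝ)⁻¹ * (1 / 4) ^ (e - 2) ≤ 2 / 3 := by
  have hinj : Set.InjOn (fun e => e - 2) (S : Set ℕ) := fun e he e' he' h =>
    (tsub_left_inj (hS e he) (hS e' he')).1 h
  have hsum : HasSum (fun j : ℕ => (1 / 2 : ℝ) * (1 / 4) ^ j) (2 / 3) := by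
    have hgeom := (hasSum_geometric_of_lt_one (r := (1 / 4 : ℝ)) (by norm_num)
      (by norm_num)).mul_left (1 / 2 : ℝ)
    rwa [show (1 / 2 : ℝ) * (1 - 1 / 4)⁻¹ = 2 / 3 by norm_num] at hgeom
  calc ∑ e ∈ S, (e : ℝ)⁻¹ * (1 / 4) ^ (e - 2)
      ≤ ∑ e ∈ S, (1 / 2 : ℝ) * (1 / 4) ^ (e - 2) := by
        refine Finset.sum_le_sum fun e he => ?_
        have htwo : (2 : ℝ) ≤ e := by exact_mod_cast hS e he
        rw [one_div 2]
        gcongr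
    _ = ∑ j ∈ S.image (· - 2), (1 / 2 : ℝ) * (1 / 4) ^ j :=
        (Finset.sum_image (f := fun j => (1 / 2 : ℝ) * (1 / 4) ^ j) hinj).symm
    _ ≤ 2 / 3 := sum_le_hasSum _ (fun _ _ => by positivity) hsum

theorem card_tuplesLE_le (S : Finset ℕ) (v z : ℕ) : (tuplesLE S v z).card ≤ S.card ^ v :=
  (Finset.card_filter_le _ _).trans_eq (by simp)

theorem sum_tuplesLE_prod_inv_le (hS : ∀ e ∈ S, 2 ≤ e) (v z : ℕ) :
    ∑ d ∈ tuplesLE S v z, ∏ i, (d i : ℝ)⁻¹ ≤ (((S.card : ℝ) + 1) / 3) ^ v := by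
  calc ∑ d ∈ tuplesLE S v z, ∏ i, (d i : ℝ)⁻¹
      ≤ ∑ d ∈ Fintype.piFinset fun _ : Fin v => S, ∏ i, (d i : ℝ)⁻¹ :=
        Finset.sum_le_sum_of_subset_of_nonneg (Finset.filter_subset _ _)
          fun _ _ _ => by positivity
    _ = (∑ e ∈ S, (e : ℝ)⁻¹) ^ v := by
        rw [Finset.sum_prod_piFinset S fun (_ : Fin v) (e : ℕ) => (e : ℝ)⁻¹,
          Finset.prod_const, Finset.card_univ, Fintype.card_fin]
    _ ≤ _ := by
        gcongr
        exact sum_inv_le hS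

theorem le_mul_half_pow {H : ℕ → ℝ} (hH : ∀ m, 0 < m → H (m + 1) ≤ H m / 2) {m : ℕ} (hm : 0 < m)
    (a : ℕ) : H (m + a) ≤ H m * (1 / 2) ^ a := by
  induction a with
  | zero => simp
  | succ a ih =>
    calc H (m + a + 1) ≤ H (m + a) / 2 := hH _ (by lia)
      _ ≤ H m * (1 / 2) ^ a / 2 := by gcongr
      _ = H m * (1 / 2) ^ (a + 1) := by ring

variable {ι : Type*} [Fintype ι]

theorem nonneg_of_sum_abs_le {V : ℕ → ι → ℝ} {H : ℕ → ℝ}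
    (hV : ∀ t, 0 < t → ∑ i, |V t i| ≤ H t) {t : ℕ} (ht : 0 < t) : 0 ≤ H t :=
  (Finset.sum_nonneg fun _ _ => abs_nonneg _).trans (hV t ht)

variable [DecidableEq ι] {A : ℕ → Matrix ι ι ℝ}

theorem abs_tupleProd_le {c : ℕ → ℝ} {v : ℕ} {d : Fin (v + 1) → ℕ}
    (hA : ∀ i j k, |A (d i) j k| ≤ c (d i)) (j k : ι) :
    |tupleProd A d j k| ≤ (Fintype.card ι : ℝ) ^ v * ∏ i, c (d i) := by
  induction v generalizing j k with
  | zero => simpa [tupleProd] using hA 0 j k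
  | succ v ih =>
    have hc (i) : 0 ≤ c (d i) := (abs_nonneg _).trans (hA i j k)
    have hmul : tupleProd A d = tupleProd A (Fin.init d) * A (d (Fin.last _)) := by
      rw [← tupleProd_snoc, Fin.snoc_init_self]
    calc |tupleProd A d j k|
        ≤ ∑ l, |tupleProd A (Fin.init d) j l * A (d (Fin.last _)) l k| := by
          rw [hmul, Matrix.mul_apply]
          exact Finset.abs_sum_le_sum_abs _ _
      _ ≤ ∑ _l : ι, (Fintype.card ι : ℝ) ^ v * (∏ i, c (Fin.init d i)) * c (d (Fin.last _)) := by
          refine Finset.sum_le_sum fun l _ => ?_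
          rw [abs_mul]
          exact mul_le_mul (ih (fun i => hA i.castSucc) j l) (hA _ l k) (abs_nonneg _)
            (mul_nonneg (by positivity) (Finset.prod_nonneg fun i _ => hc i.castSucc))
      _ = (Fintype.card ι : ℝ) ^ (v + 1) * ∏ i, c (d i) := by
          rw [Finset.sum_const, Finset.card_univ, nsmul_eq_mul,
            Fin.prod_univ_castSucc fun i => c (d i), pow_succ]
          simp only [Fin.init_def]
          ring

variable {V : ℕ → ι → ℝ} {H : ℕ → ℝ}

theorem norm_tupleVec_le {v : ℕ} {d : Fin (v + 1) → ℕ}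
    (hA : ∀ i j k, |A (d i) j k| ≤ (d i : ℝ)⁻¹) (hV : ∑ j, |V (∏ i, d i) j| ≤ H (∏ i, d i)) :
    ‖tupleVec A V d‖ ≤ (Fintype.card ι : ℝ) ^ v * (∏ i, (d i : ℝ)⁻¹) * H (∏ i, d i) := by
  have hH : 0 ≤ H (∏ i, d i) := (Finset.sum_nonneg fun _ _ => abs_nonneg _).trans hV
  refine (pi_norm_le_iff_of_nonneg (by positivity)).2 fun j => ?_
  calc |∑ k, tupleProd A d j k * V (∏ i, d i) k|
      ≤ ∑ k, (Fintype.card ι : ℝ) ^ v * (∏ i, (d i : ℝ)⁻¹) * |V (∏ i, d i) k| := by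
        refine (Finset.abs_sum_le_sum_abs _ _).trans (Finset.sum_le_sum fun k _ => ?_)
        rw [abs_mul]
        gcongr
        exact abs_tupleProd_le (c := fun e => (e : ℝ)⁻¹) hA j k
    _ ≤ _ := by
        rw [← Finset.mul_sum]
        gcongr

variable (hS : ∀ e ∈ S, 2 ≤ e) (hA : ∀ e ∈ S, ∀ i j, |A e i j| ≤ (e : ℝ)⁻¹)
  (hV : ∀ t, 0 < t → ∑ i, |V t i| ≤ H t) (hH : ∀ m, 0 < m → H (m + 1) ≤ H m / 2)

include hS hA hV in
theorem norm_tupleVec_snoc_le {v : ℕ} {d : Fin v → ℕ} (hd : ∀ i, d i ∈ S) {e : ℕ} (he : e ∈ S) :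
    ‖tupleVec A V (Fin.snoc d e : Fin (v + 1) → ℕ)‖ ≤
      (Fintype.card ι : ℝ) ^ v * ((∏ i, (d i : ℝ)⁻¹) * (e : ℝ)⁻¹) * H ((∏ i, d i) * e) := by
  have hsnoc := forall_snoc_mem hd he
  refine (norm_tupleVec_le (fun i => hA _ (hsnoc i)) (hV _ (Finset.prod_pos fun i _ =>
    two_pos.trans_le (hS _ (hsnoc i))))).trans_eq ?_
  rw [Fin.prod_snoc, Fin.prod_univ_castSucc]
  simp only [Fin.snoc_castSucc, Fin.snoc_last]

include hS hA hV hH in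
theorem norm_tupleVec_snoc_le_of_one_le {k : ℕ} (hk : 1 ≤ k) {d : Fin k → ℕ} (hd : ∀ i, d i ∈ S)
    {e : ℕ} (he : e ∈ S) :
    ‖tupleVec A V (Fin.snoc d e : Fin (k + 1) → ℕ)‖ ≤ (Fintype.card ι : ℝ) ^ k *
      H (2 ^ (k + 1)) * ((∏ i, (d i : ℝ)⁻¹) * ((e : ℝ)⁻¹ * (1 / 4) ^ (e - 2))) := by
  obtain ⟨f, rfl⟩ := Nat.exists_eq_add_of_le (hS e he)
  have hprod : 2 ^ (k + 1) + 2 * f ≤ (∏ i, d i) * (2 + f) := by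
    have htwo : 2 ≤ 2 ^ k := Nat.le_self_pow (by lia) 2
    calc 2 ^ (k + 1) + 2 * f ≤ 2 ^ k * (2 + f) := by
          rw [mul_add, pow_succ]
          gcongr
      _ ≤ _ := by
          gcongr
          exact two_pow_le_prod hS hd
  obtain ⟨b, hb⟩ := Nat.exists_eq_add_of_le hprod
  have hpos : 0 < 2 ^ (k + 1) := by positivity
  have hH₀ : 0 ≤ H (2 ^ (k + 1)) := nonneg_of_sum_abs_le hV hpos
  have hdecay : H ((∏ i, d i) * (2 + f)) ≤ H (2 ^ (k + 1)) * (1 / 4) ^ f := by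
    calc H ((∏ i, d i) * (2 + f)) ≤ H (2 ^ (k + 1)) * (1 / 2) ^ (2 * f + b) := by
          rw [hb, add_assoc]
          exact le_mul_half_pow hH hpos _
      _ ≤ H (2 ^ (k + 1)) * (1 / 2) ^ (2 * f) := by
          refine mul_le_mul_of_nonneg_left ?_ hH₀
          exact pow_le_pow_of_le_one (by norm_num) (by norm_num) (Nat.le_add_right _ _)
      _ = _ := by
          rw [pow_mul]
          norm_num
  refine (norm_tupleVec_snoc_le hS hA hV hd he).trans ?_
  refine (mul_le_mul_of_nonneg_left hdecay (by positivity)).trans_eq ?_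
  rw [Nat.add_sub_cancel_left]
  ring

include hS hA hV hH in
theorem sum_norm_tupleVec_snoc_le {k : ℕ} (hk : 1 ≤ k) (z : ℕ) :
    ∑ d ∈ tuplesLE S k z, ∑ e ∈ S, ‖tupleVec A V (Fin.snoc d e : Fin (k + 1) → ℕ)‖ ≤
      1 / 2 * ((Fintype.card ι : ℝ) * ((S.card : ℝ) + 1) / 2) ^ k * H (2 ^ (k + 1)) := by
  set n : ℝ := (Fintype.card ι : ℝ)
  set D : ℝ := (S.card : ℝ) + 1
  set h := H (2 ^ (k + 1))
  have hh : 0 ≤ h := nonneg_of_sum_abs_le hV (by positivity)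
  calc ∑ d ∈ tuplesLE S k z, ∑ e ∈ S, ‖tupleVec A V (Fin.snoc d e : Fin (k + 1) → ℕ)‖
      ≤ ∑ d ∈ tuplesLE S k z, ∑ e ∈ S,
          n ^ k * h * ((∏ i, (d i : ℝ)⁻¹) * ((e : ℝ)⁻¹ * (1 / 4) ^ (e - 2))) :=
        Finset.sum_le_sum fun d hd => Finset.sum_le_sum fun e he =>
          norm_tupleVec_snoc_le_of_one_le hS hA hV hH hk (mem_tuplesLE.1 hd).1 he
    _ = n ^ k * h * ((∑ d ∈ tuplesLE S k z, ∏ i, (d i : ℝ)⁻¹) *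
          ∑ e ∈ S, (e : ℝ)⁻¹ * (1 / 4) ^ (e - 2)) := by
        simp_rw [Finset.sum_mul_sum, Finset.mul_sum]
    _ ≤ n ^ k * h * ((D / 3) ^ k * (2 / 3)) := by
        gcongr
        exacts [sum_tuplesLE_prod_inv_le hS k z, sum_inv_mul_quarter_pow_le hS]
    _ = (2 / 3) ^ (k + 1) * ((n * D / 2) ^ k * h) := by
        rw [show D / 3 = D / 2 * (2 / 3) by ring, mul_pow, mul_div_assoc, mul_pow n]
        ring
    _ ≤ 1 / 2 * ((n * D / 2) ^ k * h) := by
        gcongr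
        calc (2 / 3 : ℝ) ^ (k + 1) ≤ (2 / 3) ^ 2 :=
              pow_le_pow_of_le_one (by norm_num) (by norm_num) (by lia)
          _ ≤ 1 / 2 := by norm_num
    _ = 1 / 2 * (n * D / 2) ^ k * h := (mul_assoc _ _ _).symm

include hS hA hV hH in
theorem norm_tupleVec_snoc_le_of_lt {v k : ℕ} {d : Fin v → ℕ} (hd : ∀ i, d i ∈ S) {e : ℕ}
    (he : e ∈ S) (hlt : 2 ^ (k + 1) < (∏ i, d i) * e) :
    ‖tupleVec A V (Fin.snoc d e : Fin (v + 1) → ℕ)‖ ≤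
      (Fintype.card ι : ℝ) ^ v * (((2 : ℝ) ^ (k + 1))⁻¹ * H (2 ^ (k + 1))) := by
  obtain ⟨b, hb⟩ := Nat.exists_eq_add_of_le hlt.le
  have hpos : 0 < 2 ^ (k + 1) := by positivity
  have hH₀ : 0 ≤ H (2 ^ (k + 1)) := nonneg_of_sum_abs_le hV hpos
  have hdecay : H ((∏ i, d i) * e) ≤ H (2 ^ (k + 1)) := by
    rw [hb]
    exact (le_mul_half_pow hH hpos b).trans
      (mul_le_of_le_one_right hH₀ (pow_le_one₀ (by norm_num) (by norm_num)))
  have hH₁ : 0 ≤ H ((∏ i, d i) * e) := nonneg_of_sum_abs_le hV (hpos.trans hlt)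
  have hinv : (∏ i, (d i : ℝ)⁻¹) * (e : ℝ)⁻¹ ≤ ((2 : ℝ) ^ (k + 1))⁻¹ := by
    rw [Finset.prod_inv_distrib, ← mul_inv]
    exact inv_anti₀ (by positivity) (by exact_mod_cast hlt.le)
  calc ‖tupleVec A V (Fin.snoc d e : Fin (v + 1) → ℕ)‖
      ≤ (Fintype.card ι : ℝ) ^ v * ((∏ i, (d i : ℝ)⁻¹) * (e : ℝ)⁻¹) * H ((∏ i, d i) * e) :=
        norm_tupleVec_snoc_le hS hA hV hd he
    _ ≤ (Fintype.card ι : ℝ) ^ v * ((2 : ℝ) ^ (k + 1))⁻¹ * H (2 ^ (k + 1)) := by gcongr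
    _ = _ := mul_assoc _ _ _

include hS hA hV hH in
theorem sum_norm_tupleVec_snoc_le_of_lt [Nonempty ι] {v k : ℕ} (hv : v < k) :
    ∑ d ∈ tuplesLE S v (2 ^ (k + 1)), ∑ e ∈ S with ¬ (∏ i, d i) * e ≤ 2 ^ (k + 1),
        ‖tupleVec A V (Fin.snoc d e : Fin (v + 1) → ℕ)‖ ≤
      1 / 2 * (1 / (Fintype.card ι : ℝ)) *
        ((Fintype.card ι : ℝ) * ((S.card : ℝ) + 1) / 2) ^ k * H (2 ^ (k + 1)) := by
  set n : ℝ := (Fintype.card ι : ℝ)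
  set D : ℝ := (S.card : ℝ) + 1
  set h := H (2 ^ (k + 1))
  have hh : 0 ≤ h := nonneg_of_sum_abs_le hV (by positivity)
  have hn₁ : 1 ≤ n := Nat.one_le_cast.2 Fintype.card_pos
  calc ∑ d ∈ tuplesLE S v (2 ^ (k + 1)), ∑ e ∈ S with ¬ (∏ i, d i) * e ≤ 2 ^ (k + 1),
        ‖tupleVec A V (Fin.snoc d e : Fin (v + 1) → ℕ)‖
      ≤ ∑ d ∈ tuplesLE S v (2 ^ (k + 1)), ∑ e ∈ S with ¬ (∏ i, d i) * e ≤ 2 ^ (k + 1),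
          n ^ v * (((2 : ℝ) ^ (k + 1))⁻¹ * h) :=
        Finset.sum_le_sum fun d hd => Finset.sum_le_sum fun e he =>
          norm_tupleVec_snoc_le_of_lt hS hA hV hH (mem_tuplesLE.1 hd).1 (Finset.mem_filter.1 he).1
            (not_le.1 (Finset.mem_filter.1 he).2)
    _ ≤ (S.card : ℝ) ^ v * (S.card * (n ^ v * (((2 : ℝ) ^ (k + 1))⁻¹ * h))) := by
        simp only [Finset.sum_const, nsmul_eq_mul]
        refine (Finset.sum_le_card_nsmul _ _ (S.card * (n ^ v * (((2 : ℝ) ^ (k + 1))⁻¹ * h)))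
          fun d _ => ?_).trans ?_
        · gcongr
          exact Finset.filter_subset _ _
        · rw [nsmul_eq_mul]
          gcongr
          exact_mod_cast card_tuplesLE_le S v _
    _ = (S.card : ℝ) ^ (v + 1) * n ^ v * (((2 : ℝ) ^ (k + 1))⁻¹ * h) := by ring
    _ ≤ D ^ k * n ^ (k - 1) * (((2 : ℝ) ^ (k + 1))⁻¹ * h) := by
        gcongr
        · exact (pow_le_pow_left₀ (by positivity) (le_add_of_nonneg_right zero_le_one) _).trans
            (pow_le_pow_right₀ (le_add_of_nonneg_left (by positivity)) hv)
        · lia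
    _ = 1 / 2 * (1 / n) * (n * D / 2) ^ k * h := by
        obtain ⟨j, rfl⟩ := Nat.exists_eq_add_of_le' (Nat.succ_le_of_lt (Nat.zero_lt_of_lt hv))
        rw [Nat.add_sub_cancel, div_pow, mul_pow]
        field_simp
        ring

variable {W : ℕ → ι → ℝ}

include hS hA hV hH in
theorem norm_sub_truncatedInversion_le [Nonempty ι]
    (hW : ∀ t, 0 < t → W t = V t + ∑ e ∈ S, A e *ᵥ V (t * e)) {k : ℕ} (hk : 1 ≤ k) :
    ‖V 1 - truncatedInversion S A W (k + 1) (2 ^ (k + 1))‖ ≤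
      1 / 2 * (1 + (k : ℝ) / (Fintype.card ι : ℝ)) *
        ((Fintype.card ι : ℝ) * ((S.card : ℝ) + 1) / 2) ^ k * H (2 ^ (k + 1)) := by
  rw [sub_truncatedInversion (fun e he => two_pos.trans_le (hS e he)) hW Nat.one_le_two_pow]
  have hlong : ‖(-1 : ℝ) ^ (k + 1) • ∑ d ∈ tuplesLE S k (2 ^ (k + 1)), ∑ e ∈ S,
      tupleVec A V (Fin.snoc d e : Fin (k + 1) → ℕ)‖ ≤
        1 / 2 * ((Fintype.card ι : ℝ) * ((S.card : ℝ) + 1) / 2) ^ k * H (2 ^ (k + 1)) := by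
    rw [norm_smul, norm_pow, norm_neg, norm_one, one_pow, one_mul]
    exact (norm_sum_le_of_le _ fun d _ => norm_sum_le _ _).trans
      (sum_norm_tupleVec_snoc_le hS hA hV hH hk _)
  have hshort (v : ℕ) (hv : v ∈ Finset.range k) :
      ‖(-1 : ℝ) ^ v • ∑ d ∈ tuplesLE S v (2 ^ (k + 1)),
        ∑ e ∈ S with ¬ (∏ i, d i) * e ≤ 2 ^ (k + 1),
          tupleVec A V (Fin.snoc d e : Fin (v + 1) → ℕ)‖ ≤
        1 / 2 * (1 / (Fintype.card ι : ℝ)) *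
          ((Fintype.card ι : ℝ) * ((S.card : ℝ) + 1) / 2) ^ k * H (2 ^ (k + 1)) := by
    rw [norm_smul, norm_pow, norm_neg, norm_one, one_pow, one_mul]
    exact (norm_sum_le_of_le _ fun d _ => norm_sum_le _ _).trans
      (sum_norm_tupleVec_snoc_le_of_lt hS hA hV hH (Finset.mem_range.1 hv))
  refine (norm_sub_le _ _).trans
    ((add_le_add hlong (norm_sum_le_of_le _ hshort)).trans_eq ?_)
  rw [Finset.sum_const, Finset.card_range, nsmul_eq_mul]
  ring

end Estimates

section Approximation

variable {q : ℕ} [NeZero q] {P s : ℝ}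

instance {G : Type} [CommGroup G] : Nonempty (LatticeClass G) :=
  ⟨classOf 1⟩

theorem approx_eq_truncatedInversion (P s : ℝ) (r : ℕ) :
    approx q P s r = truncatedInversion ((Monoid.exponent (ZMod q)ˣ).divisors.erase 1)
      (fun d => (d : ℝ)⁻¹ • NClass d) (fun t => M1Inv *ᵥ GammaVec q P s t) r (2 ^ r) := by
  simp only [truncatedInversion, tupleVec, Matrix.mulVec_mulVec]
  rfl

theorem norm_VVec_sub_approx_le (hP : 2 ≤ P) (hs : 1 < s) {k : ℕ} (hk : 1 ≤ k) :
    ‖VVec q P s - approx q P s (k + 1)‖ ≤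
      1 / 2 * (1 + (k : ℝ) / Fintype.card (LatticeClass (ZMod q)ˣ)) *
        (Fintype.card (LatticeClass (ZMod q)ˣ) *
          (Monoid.exponent (ZMod q)ˣ).divisors.card / 2) ^ k *
        tailBound P ((2 ^ (k + 1) : ℕ) * s) := by
  have hone : 1 ∈ (Monoid.exponent (ZMod q)ˣ).divisors :=
    Nat.one_mem_divisors.2 Monoid.exponent_ne_zero_of_finite
  have htwo : ∀ e ∈ (Monoid.exponent (ZMod q)ˣ).divisors.erase 1, 2 ≤ e := fun e he => by
    have := Nat.pos_of_mem_divisors (Finset.mem_of_mem_erase he)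
    have := Finset.ne_of_mem_erase he
    lia
  have hV (t : ℕ) (ht : 0 < t) :
      ∑ A, |VVec q P (t * s) A| ≤ tailBound P (t * s) := by
    have hσ := one_lt_natCast_mul ht hs
    simp_rw [abs_of_nonneg (VVec_nonneg P _ hσ)]
    exact sum_VVec_le (by linarith) hσ
  have hdecay (m : ℕ) (hm : 0 < m) :
      tailBound P ((m + 1 : ℕ) * s) ≤ tailBound P (m * s) / 2 := by
    rw [Nat.cast_add_one, add_one_mul]
    exact tailBound_add_le_half hP (one_lt_natCast_mul hm hs) hs.le
  have h := norm_sub_truncatedInversion_le (V := fun t => VVec q P (t * s)) htwo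
    (fun e he => abs_inv_smul_NClass_le (by have := htwo e he; lia)) hV hdecay
    (fun t ht => M1Inv_mulVec_GammaVec P hs ht) hk
  rwa [← approx_eq_truncatedInversion, ← Nat.cast_add_one, Finset.card_erase_add_one hone,
    Nat.cast_one, one_mul] at h

end Approximation

end LatticeEuler

theorem mainTheorem1 (q : ℕ) [NeZero q] (hq : 1 < q) (s : ℝ) (hs : 1 < s) (P : ℝ) (hP : 2 ≤ P) :
    -- the Euler products involved converge, and the products of L-values are positive reals
    (∀ A : LatticeEuler.LatticeClass (ZMod q)ˣ,
      Multipliable fun p : LatticeEuler.PrimeGEIn P q A.1 => LatticeEuler.zetaFactor s p.1) ∧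
    (∀ (χ : DirichletCharacter ℂ q) (t : ℕ), 1 ≤ t →
      Multipliable fun p : LatticeEuler.PrimeGE P =>
        LatticeEuler.LFactor χ (((t : ℝ) * s : ℝ) : ℂ) p.1) ∧
    (∀ (G₀ : Subgroup (ZMod q)ˣ) (t : ℕ), 1 ≤ t →
      (LatticeEuler.LProd P s G₀ t).im = 0 ∧ 0 < (LatticeEuler.LProd P s G₀ t).re) ∧
    -- the approximation
    ∀ r : ℕ, 2 ≤ r →
      ‖LatticeEuler.VVec q P s - LatticeEuler.approx q P s r‖ ≤
        1 / 2 *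
          (1 + ((r : ℝ) - 1) / (Fintype.card (LatticeEuler.LatticeClass (ZMod q)ˣ) : ℝ)) *
          ((Fintype.card (LatticeEuler.LatticeClass (ZMod q)ˣ) : ℝ) *
            ((Monoid.exponent (ZMod q)ˣ).divisors.card : ℝ) / 2) ^ (r - 1) *
          ((1 + P / (s * 2 ^ r - 1)) / P ^ (s * 2 ^ r)) := by
  refine ⟨fun A => LatticeEuler.multipliable_zetaFactor P A.1 hs,
    fun χ t ht => LatticeEuler.multipliable_LFactor χ P (LatticeEuler.one_lt_natCast_mul ht hs),
    fun G₀ t ht => ?_, fun r hr => ?_⟩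
  · rw [LatticeEuler.LProd_eq_exp G₀ P hs ht]
    exact ⟨Complex.ofReal_im _, Real.exp_pos _⟩
  · obtain ⟨k, rfl⟩ := Nat.exists_eq_add_of_le' (one_le_two.trans hr)
    have hbound := LatticeEuler.norm_VVec_sub_approx_le (q := q) hP hs (Nat.le_of_succ_le_succ hr)
    rw [LatticeEuler.tailBound, mul_comm _ s, Nat.cast_pow, Nat.cast_ofNat] at hbound
    rwa [Nat.cast_add_one, add_sub_cancel_right, Nat.add_sub_cancel]
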